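/- Let $T=(S^1)^n$ be a torus with Lie algebra $\mathfrak t$, acting smoothly on a (Hausdorff, finite-dimensional, boundaryless) smooth manifold $X$. For $p\in X$ let $T_p$ be the isotropy group of $p$, $\mathfrak t_p$ its Lie algebra (the infinitesimal isotropy at $p$), and $S(\mathfrak t_p^*)$ the algebra of polynomial functions on $\mathfrak t_p$. An infinitesimal stratum is a connected component $Y$ of a set of the form $\{p\in X\mid \mathfrak t_p=\mathfrak h\}$, where $\mathfrak h$ is an infinitesimal isotropy; put $\mathfrak t_Y:=\mathfrak t_p$ for $p\in Y$. Write $Y\preceq Z$ if $Y\subset\overline Z$; this implies $\mathfrak t_Z\subset\mathfrak t_Y$. Consider the following two notions. (1) A pointwise polynomial assignment is a map $A$ that assigns to each $p\in X$ a polynomial $A(p)\in S(\mathfrak t_p^*)$ such that for every closed connected subgroup (subtorus) $H\subset T$ with Lie algebra $\mathfrak h$, the map $p\mapsto A(p)|_{\mathfrak h}$ is locally constant on the fixed point set $X^H$. (2) A Guillemin–Sabatini–Zara polynomial assignment is a map $A'$ that assigns to each infinitesimal stratum $Y$ a polynomial $A'(Y)\in S(\mathfrak t_Y^*)$ such that $A'(Z)=A'(Y)|_{\mathfrak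 t_Z}$ whenever $Y\preceq Z$. Then the two notions are equivalent in the following sense. (a) If $A$ is as in (1), then $A$ is constant on each infinitesimal stratum $Y$; if $A'(Y)$ denotes the common value of all $A(p)$, $p\in Y$, then $A'$ is as in (2). (b) If $A'$ is as in (2), then the map $A$ given by $A(p):=A'(Y)$, where $Y$ is the stratum containing $p$, is as in (1). -/

import Mathlib

open scoped Manifold ContDiff

noncomputable section

namespace TorusAssignment

/-! ### Polynomial functions on a real vector space -/

/-- The algebra `S(V*)` of polynomial functions on a real vector space `V`: the algebra of
real-valued functions on `V` generated by the linear forms. -/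
def polyFun (V : Type*) [AddCommGroup V] [Module ℝ V] : Subalgebra ℝ (V → ℝ) :=
  Algebra.adjoin ℝ (Set.range fun φ : Module.Dual ℝ V => (φ : V → ℝ))

theorem comp_mem_polyFun {V W : Type*} [AddCommGroup V] [Module ℝ V] [AddCommGroup W]
    [Module ℝ W] (L : W →ₗ[ℝ] V) {f : V → ℝ} (hf : f ∈ polyFun V) : f ∘ L ∈ polyFun W := by
  unfold polyFun at hf
  induction hf using Algebra.adjoin_induction with
  | mem x hx =>
    obtain ⟨φ, rfl⟩ := hx
    exact Algebra.subset_adjoin ⟨φ.comp L, rfl⟩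
  | algebraMap r => exact (polyFun W).algebraMap_mem r
  | add x y _ _ hx hy => exact (polyFun W).add_mem hx hy
  | mul x y _ _ hx hy => exact (polyFun W).mul_mem hx hy

/-- Restriction `f ↦ f|_W` of polynomial functions from a linear subspace `V` to a smaller
subspace `W`.  For `W = V` it merely identifies `S(V*)` with `S(W*)`. -/
def restrictPoly {E : Type*} [AddCommGroup E] [Module ℝ E] {W V : Submodule ℝ E} (h : W ≤ V)
    (f : polyFun V) : polyFun W :=
  ⟨(f : V → ℝ) ∘ Submodule.inclusion h, comp_mem_polyFun (Submodule.inclusion h) f.2⟩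

/-! ### Tori, their Lie algebras and infinitesimal isotropies -/

/-- The `n`-dimensional torus `T = (S¹)ⁿ`. -/
abbrev Torus (n : ℕ) : Type := Fin n → Circle

/-- The model with corners of `T = (S¹)ⁿ`, regarded as a product of `n` copies of the
manifold `S¹`. -/
abbrev torusModel (n : ℕ) :=
  ModelWithCorners.pi (𝕜 := ℝ) (fun _ : Fin n => 𝓡 1)

/-- The exponential map `𝔱 = ℝⁿ → T` of the torus, `ξ ↦ (exp (i ξ₁), …, exp (i ξₙ))`. -/
def torusExp {n : ℕ} (ξ : Fin n → ℝ) : Torus n := fun i => Circle.exp (ξ i)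

theorem torusExp_zero {n : ℕ} : torusExp (0 : Fin n → ℝ) = 1 := by
  ext i; simp [torusExp]

theorem torusExp_add {n : ℕ} (ξ η : Fin n → ℝ) :
    torusExp (ξ + η) = torusExp ξ * torusExp η := by
  ext i; simp [torusExp, Circle.exp_add]

/-- The Lie algebra of a subgroup `H` of `T`, as a subspace of `𝔱 = ℝⁿ`: it consists of those
`ξ` whose one-parameter group `s ↦ exp (s ξ)` lies in `H`. -/
def lieAlg {n : ℕ} (H : Subgroup (Torus n)) : Submodule ℝ (Fin n → ℝ) where
  carrier := {ξ | ∀ s : ℝ, torusExp (s • ξ) ∈ H}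
  zero_mem' := fun s => by rw [smul_zero, torusExp_zero]; exact H.one_mem
  add_mem' := fun {ξ η} hξ hη s => by
    rw [smul_add, torusExp_add]; exact H.mul_mem (hξ s) (hη s)
  smul_mem' := fun c ξ hξ s => by
    have h := hξ (s * c)
    rwa [mul_smul] at h

theorem mem_lieAlg {n : ℕ} {H : Subgroup (Torus n)} {ξ : Fin n → ℝ} :
    ξ ∈ lieAlg H ↔ ∀ s : ℝ, torusExp (s • ξ) ∈ H := Iff.rfl

/-- The infinitesimal isotropy `𝔱_p` at `p`: the Lie algebra of the isotropy group `T_p`. -/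
def isotropy (n : ℕ) {X : Type*} [MulAction (Torus n) X] (p : X) : Submodule ℝ (Fin n → ℝ) :=
  lieAlg (MulAction.stabilizer (Torus n) p)

theorem lieAlg_le_isotropy {n : ℕ} {X : Type*} [MulAction (Torus n) X]
    (H : Subgroup (Torus n)) {p : X} (hp : p ∈ MulAction.fixedPoints H X) :
    lieAlg H ≤ isotropy n p :=
  fun _ hξ s => hp ⟨_, hξ s⟩

/-! ### The pointwise definition of polynomial assignments -/

/-- Pointwise definition of a polynomial assignment: a family `A p ∈ S(𝔱_p*)`, `p ∈ X`, such
that for every subtorus (closed connected subgroup) `H` of `T` the map `p ↦ A p |_𝔥` is locally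
constant on the fixed point set `X^H`, the latter with the subspace topology. -/
def IsPointwiseAssignment {n : ℕ} {X : Type*} [TopologicalSpace X] [MulAction (Torus n) X]
    (A : ∀ p : X, polyFun (isotropy n p)) : Prop :=
  ∀ H : Subgroup (Torus n), IsClosed (H : Set (Torus n)) → IsConnected (H : Set (Torus n)) →
    IsLocallyConstant fun p : MulAction.fixedPoints H X =>
      restrictPoly (lieAlg_le_isotropy H p.2) (A p)

/-! ### Infinitesimal orbit-type strata and assignments on them -/

/-- An infinitesimal orbit-type stratum: a connected component of a set
`{q | 𝔱_q = 𝔥}`, where `𝔥 = 𝔱_p` is an infinitesimal isotropy.  (It is the component of a point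
`p` of that set.) -/
structure Stratum (n : ℕ) (X : Type*) [TopologicalSpace X] [MulAction (Torus n) X] where
  carrier : Set X
  exists_eq : ∃ p : X, carrier = connectedComponentIn {q : X | isotropy n q = isotropy n p} p

namespace Stratum

variable {n : ℕ} {X : Type*} [TopologicalSpace X] [MulAction (Torus n) X]

theorem nonempty (Y : Stratum n X) : Y.carrier.Nonempty := by
  obtain ⟨p, hp⟩ := Y.exists_eq
  exact ⟨p, hp ▸ mem_connectedComponentIn rfl⟩

/-- `𝔱_Y := 𝔱_p`, where `p` is a point of `Y`; see `isotropy_eq` for the independence of `p`. -/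
def lie (Y : Stratum n X) : Submodule ℝ (Fin n → ℝ) := isotropy n Y.nonempty.some

theorem isotropy_eq (Y : Stratum n X) {p : X} (hp : p ∈ Y.carrier) : isotropy n p = Y.lie := by
  have h : ∀ q ∈ Y.carrier, isotropy n q = isotropy n Y.exists_eq.choose := fun q hq => by
    have hq' := hq
    rw [Y.exists_eq.choose_spec] at hq'
    exact (connectedComponentIn_subset _ _ hq' :)
  exact (h p hp).trans (h _ Y.nonempty.some_mem).symm

/-- The partial order on strata: `Y ⪯ Z` if and only if `Y` is contained in the closure
of `Z`. -/
def Precedes (Y Z : Stratum n X) : Prop := Y.carrier ⊆ closure Z.carrier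

theorem lie_le_of_precedes [T2Space X] [ContinuousSMul (Torus n) X] {Y Z : Stratum n X}
    (h : Y.Precedes Z) : Z.lie ≤ Y.lie := by
  intro ξ hξ s
  have hcl : IsClosed {q : X | torusExp (s • ξ) • q = q} :=
    isClosed_eq (continuous_const_smul _) continuous_id
  have hsub : Z.carrier ⊆ {q : X | torusExp (s • ξ) • q = q} := fun q hq => by
    have hq' : ξ ∈ isotropy n q := (Z.isotropy_eq hq).symm ▸ hξ
    exact hq' s
  exact closure_minimal hsub hcl (h Y.nonempty.some_mem)

end Stratum

/-- Guillemin–Sabatini–Zara definition of a polynomial assignment: a family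
`A' Y ∈ S(𝔱_Y*)`, indexed by the infinitesimal strata, with `A' Z = A' Y |_{𝔱_Z}` whenever
`Y ⪯ Z`. -/
def IsStratumAssignment {n : ℕ} {X : Type*} [TopologicalSpace X] [T2Space X]
    [MulAction (Torus n) X] [ContinuousSMul (Torus n) X]
    (A' : ∀ Y : Stratum n X, polyFun Y.lie) : Prop :=
  ∀ (Y Z : Stratum n X) (h : Y.Precedes Z),
    A' Z = restrictPoly (Stratum.lie_le_of_precedes h) (A' Y)

/-- `A p`, for a point `p` of the stratum `Y`, regarded as an element of `S(𝔱_Y*)` by means of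
the equality `𝔱_p = 𝔱_Y`. -/
def valueOn {n : ℕ} {X : Type*} [TopologicalSpace X] [MulAction (Torus n) X]
    (A : ∀ p : X, polyFun (isotropy n p)) (Y : Stratum n X) {p : X} (hp : p ∈ Y.carrier) :
    polyFun Y.lie :=
  restrictPoly (Y.isotropy_eq hp).ge (A p)

end TorusAssignment

end

open TorusAssignment

namespace TorusAssignment

open Set Filter Topology

/-! ### The closed subgroup generated by a subspace of the Lie algebra -/

/-! For a subspace `V` of `𝔱`, the closure of `exp V` is a subtorus, and it fixes `q` exactly when
`V ≤ 𝔱_q`. Hence in notion (1) the restriction `A(q)|_V` is locally constant on `{q | V ≤ 𝔱_q}`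
(`apply_eq_of_isotropy`). Part (a) follows formally: `V = 𝔱_Y` gives constancy on the connected set
`Y`, and `V = 𝔱_Z` near a point of `Y ⊆ closure Z` gives compatibility.

Part (b) needs geometry: for `q` near `p`, the stratum of `p` must precede that of `q`, so that
`A(q)` is a restriction of `A(p)`. Isotropy is upper semicontinuous (`eventually_isotropy_le`), so
near `p` it is read off from the subtorus generated by `𝔱_p`, which acts linearly in a suitable
chart (`exists_equivariant_chart`). There the segment from a fixed vector to `q` stays in the
stratum of `q` except perhaps at the fixed end (`isLocallyConical`). A connectedness argument
globalises this (`precedes_of_mem_closure`). -/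

theorem continuous_torusExp {n : ℕ} : Continuous (torusExp : (Fin n → ℝ) → Torus n) :=
  continuous_pi fun i => Circle.exp.continuous.comp (continuous_apply i)

/-- The closure of the image of a subspace `V ⊆ 𝔱` under the exponential map. -/
noncomputable def expClosure {n : ℕ} (V : Submodule ℝ (Fin n → ℝ)) : Subgroup (Torus n) :=
  Subgroup.topologicalClosure
    { carrier := torusExp '' V
      one_mem' := ⟨0, V.zero_mem, torusExp_zero⟩
      mul_mem' := by
        rintro _ _ ⟨ξ, hξ, rfl⟩ ⟨η, hη, rfl⟩
        exact ⟨ξ + η, V.add_mem hξ hη, torusExp_add ξ η⟩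
      inv_mem' := by
        rintro _ ⟨ξ, hξ, rfl⟩
        refine ⟨-ξ, V.neg_mem hξ, eq_inv_of_mul_eq_one_left ?_⟩
        rw [← torusExp_add, neg_add_cancel, torusExp_zero] }

theorem isClosed_expClosure {n : ℕ} (V : Submodule ℝ (Fin n → ℝ)) :
    IsClosed (expClosure V : Set (Torus n)) := isClosed_closure

theorem isConnected_expClosure {n : ℕ} (V : Submodule ℝ (Fin n → ℝ)) :
    IsConnected (expClosure V : Set (Torus n)) :=
  ((V.convex.isConnected ⟨0, V.zero_mem⟩).image _ continuous_torusExp.continuousOn).closure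

theorem torusExp_mem_expClosure {n : ℕ} {V : Submodule ℝ (Fin n → ℝ)} {ξ : Fin n → ℝ}
    (hξ : ξ ∈ V) : torusExp ξ ∈ expClosure V :=
  subset_closure (mem_image_of_mem _ hξ)

theorem le_lieAlg_expClosure {n : ℕ} (V : Submodule ℝ (Fin n → ℝ)) :
    V ≤ lieAlg (expClosure V) :=
  fun _ hξ s => torusExp_mem_expClosure (V.smul_mem s hξ)

section Action

variable {n : ℕ} {X : Type*} [TopologicalSpace X] [T2Space X] [MulAction (Torus n) X]
  [ContinuousSMul (Torus n) X]

theorem isClosed_stabilizer (p : X) :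
    IsClosed (MulAction.stabilizer (Torus n) p : Set (Torus n)) :=
  isClosed_eq (f := fun g : Torus n => g • p) (by fun_prop) continuous_const

theorem expClosure_le_stabilizer {V : Submodule ℝ (Fin n → ℝ)} {p : X} (h : V ≤ isotropy n p) :
    expClosure V ≤ MulAction.stabilizer (Torus n) p := by
  refine closure_minimal ?_ (isClosed_stabilizer p)
  rintro _ ⟨ξ, hξ, rfl⟩
  simpa using h hξ 1

theorem mem_fixedPoints_expClosure {V : Submodule ℝ (Fin n → ℝ)} {p : X}
    (h : V ≤ isotropy n p) : p ∈ MulAction.fixedPoints (expClosure V) X :=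
  fun g => expClosure_le_stabilizer h g.2

end Action

/-! ### Strata and polynomial functions -/

theorem restrictPoly_apply {V : Type*} [AddCommGroup V] [Module ℝ V] {W U : Submodule ℝ V}
    (h : W ≤ U) (f : polyFun U) (w : W) :
    (restrictPoly h f : W → ℝ) w = (f : U → ℝ) ⟨w, h w.2⟩ := rfl

namespace Stratum

variable {n : ℕ} {X : Type*} [TopologicalSpace X] [MulAction (Torus n) X]

@[ext]
theorem ext {Y Z : Stratum n X} (h : Y.carrier = Z.carrier) : Y = Z := by
  cases Y; cases Z; cases h; rfl

variable (n) in
/-- The stratum through a point. -/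
def of (p : X) : Stratum n X := ⟨_, p, rfl⟩

theorem mem_of (p : X) : p ∈ (of n p).carrier := mem_connectedComponentIn rfl

theorem eq_of_mem {Y : Stratum n X} {p : X} (hp : p ∈ Y.carrier) : Y = of n p := by
  obtain ⟨r, hr⟩ := Y.exists_eq
  ext1
  rw [hr] at hp ⊢
  have h : isotropy n p = isotropy n r := (connectedComponentIn_subset _ _ hp :)
  rw [connectedComponentIn_eq hp]
  simp only [of, h]

theorem isPreconnected (Y : Stratum n X) : IsPreconnected Y.carrier := by
  obtain ⟨p, hp⟩ := Y.exists_eq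
  rw [hp]
  exact isPreconnected_connectedComponentIn

end Stratum

/-! ### The equivalence, assuming local conicality -/

/-- The pointwise condition is applied to the subtorus `expClosure V`. Its Lie algebra may be
strictly larger than `V` when `V` is irrational, so the resulting equality is restricted once more
to `V`. -/
theorem apply_eq_of_isotropy {n : ℕ} {X : Type*} [TopologicalSpace X] [T2Space X]
    [MulAction (Torus n) X] [ContinuousSMul (Torus n) X]
    {A : ∀ p : X, polyFun (isotropy n p)} (hA : IsPointwiseAssignment A)
    (V : Submodule ℝ (Fin n → ℝ)) {p : X} (hp : V ≤ isotropy n p) :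
    ∃ U ∈ 𝓝 p, ∀ q ∈ U, ∀ hq : V ≤ isotropy n q, restrictPoly hq (A q) = restrictPoly hp (A p) := by
  have h := (hA (expClosure V) (isClosed_expClosure V) (isConnected_expClosure V)).eventually_eq
    ⟨p, mem_fixedPoints_expClosure hp⟩
  rw [nhds_subtype, eventually_comap] at h
  refine ⟨_, h, fun q hqU hq => ?_⟩
  have h1 := hqU ⟨q, mem_fixedPoints_expClosure hq⟩ rfl
  ext ξ
  exact congrFun (congrArg Subtype.val h1) ⟨ξ, le_lieAlg_expClosure V ξ.2⟩

theorem IsPointwiseAssignment.valueOn_eq {n : ℕ} {X : Type*} [TopologicalSpace X] [T2Space X]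
    [MulAction (Torus n) X] [ContinuousSMul (Torus n) X]
    {A : ∀ p : X, polyFun (isotropy n p)} (hA : IsPointwiseAssignment A)
    (Y : Stratum n X) {p q : X} (hp : p ∈ Y.carrier) (hq : q ∈ Y.carrier) :
    valueOn A Y hp = valueOn A Y hq := by
  let f : Y.carrier → polyFun Y.lie := fun r => valueOn A Y r.2
  have hf : IsLocallyConstant f := by
    rw [IsLocallyConstant.iff_eventually_eq]
    intro r
    obtain ⟨U, hU, h⟩ := apply_eq_of_isotropy hA Y.lie (Y.isotropy_eq r.2).ge
    filter_upwards [continuous_subtype_val.continuousAt.preimage_mem_nhds hU] with s hs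
    exact h s hs (Y.isotropy_eq s.2).ge
  have := Subtype.preconnectedSpace Y.isPreconnected
  exact hf.apply_eq_of_preconnectedSpace ⟨p, hp⟩ ⟨q, hq⟩

theorem IsPointwiseAssignment.isStratumAssignment {n : ℕ} {X : Type*} [TopologicalSpace X]
    [T2Space X] [MulAction (Torus n) X] [ContinuousSMul (Torus n) X]
    {A : ∀ p : X, polyFun (isotropy n p)} (hA : IsPointwiseAssignment A) :
    IsStratumAssignment fun Y : Stratum n X => valueOn A Y Y.nonempty.some_mem := by
  intro Y Z h
  have hp := Y.nonempty.some_mem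
  have hle : Z.lie ≤ isotropy n Y.nonempty.some :=
    (Stratum.lie_le_of_precedes h).trans (Y.isotropy_eq hp).ge
  obtain ⟨U, hU, hA'⟩ := apply_eq_of_isotropy hA Z.lie hle
  obtain ⟨z, hzU, hz⟩ := mem_closure_iff_nhds.1 (h hp) U hU
  calc valueOn A Z Z.nonempty.some_mem = valueOn A Z hz := hA.valueOn_eq Z _ _
    _ = _ := hA' z hzU (Z.isotropy_eq hz).ge

/-- Near `p`, every point with infinitesimal isotropy `𝔱_p` is adherent to every stratum that
comes close enough to `p`. -/
def IsLocallyConical (n : ℕ) {X : Type*} [TopologicalSpace X] [MulAction (Torus n) X]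
    (p : X) : Prop :=
  ∃ U ∈ 𝓝 p, ∀ q ∈ U, ∀ y ∈ U, isotropy n y = isotropy n p → y ∈ closure (Stratum.of n q).carrier

/-- Strata satisfy a frontier condition: the part of `Y` in the closure of `Z` is closed in `Y`, and
open by local conicality, so connectedness of `Y` makes one adherent point enough. -/
theorem precedes_of_mem_closure {n : ℕ} {X : Type*} [TopologicalSpace X] [MulAction (Torus n) X]
    (hX : ∀ p : X, IsLocallyConical n p) {Y Z : Stratum n X} {p : X}
    (hpY : p ∈ Y.carrier) (hpZ : p ∈ closure Z.carrier) : Y.Precedes Z := by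
  have := Subtype.preconnectedSpace Y.isPreconnected
  let S : Set Y.carrier := (↑) ⁻¹' closure Z.carrier
  have hclosed : IsClosed S := isClosed_closure.preimage continuous_subtype_val
  have hopen : IsOpen S := by
    rw [isOpen_iff_mem_nhds]
    intro r hr
    obtain ⟨U, hU, h⟩ := hX r
    obtain ⟨z, hzU, hz⟩ := mem_closure_iff_nhds.1 hr U hU
    filter_upwards [continuous_subtype_val.continuousAt.preimage_mem_nhds hU] with s hs
    have := h z hzU s hs ((Y.isotropy_eq s.2).trans (Y.isotropy_eq r.2).symm)
    rwa [← Stratum.eq_of_mem hz] at this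
  have hS := IsClopen.eq_univ ⟨hclosed, hopen⟩ ⟨⟨p, hpY⟩, hpZ⟩
  intro y hy
  exact (hS ▸ mem_univ (⟨y, hy⟩ : Y.carrier) : (⟨y, hy⟩ : Y.carrier) ∈ S)

theorem IsStratumAssignment.isPointwiseAssignment {n : ℕ} {X : Type*} [TopologicalSpace X]
    [T2Space X] [MulAction (Torus n) X] [ContinuousSMul (Torus n) X]
    (hX : ∀ p : X, IsLocallyConical n p)
    {A' : ∀ Y : Stratum n X, polyFun Y.lie} (hA' : IsStratumAssignment A') :
    IsPointwiseAssignment fun p : X =>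
      restrictPoly ((Stratum.of n p).isotropy_eq (Stratum.mem_of p)).le (A' (Stratum.of n p)) := by
  intro H _ _
  rw [IsLocallyConstant.iff_eventually_eq]
  intro p
  obtain ⟨U, hU, h⟩ := hX p
  filter_upwards [continuous_subtype_val.continuousAt.preimage_mem_nhds hU] with q hq
  have hprec : (Stratum.of n p.1).Precedes (Stratum.of n q.1) :=
    precedes_of_mem_closure hX (Stratum.mem_of p.1) (h q hq p (mem_of_mem_nhds hU) rfl)
  ext ξ
  have h2 := hA' _ _ hprec
  simp only [restrictPoly_apply]
  rw [h2]
  rfl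

theorem assignments_equivalent {n : ℕ} {X : Type*} [TopologicalSpace X]
    [T2Space X] [MulAction (Torus n) X] [ContinuousSMul (Torus n) X]
    (hX : ∀ p : X, IsLocallyConical n p) :
    (∀ A : ∀ p : X, polyFun (isotropy n p), IsPointwiseAssignment A →
      (∀ (Y : Stratum n X) (p q : X) (hp : p ∈ Y.carrier) (hq : q ∈ Y.carrier),
        valueOn A Y hp = valueOn A Y hq) ∧
      ∃! A' : ∀ Y : Stratum n X, polyFun Y.lie,
        (∀ (Y : Stratum n X) (p : X) (hp : p ∈ Y.carrier), valueOn A Y hp = A' Y) ∧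
        IsStratumAssignment A') ∧
    (∀ A' : ∀ Y : Stratum n X, polyFun Y.lie, IsStratumAssignment A' →
      ∃! A : ∀ p : X, polyFun (isotropy n p),
        (∀ (Y : Stratum n X) (p : X) (hp : p ∈ Y.carrier), valueOn A Y hp = A' Y) ∧
        IsPointwiseAssignment A) := by
  refine ⟨fun A hA => ⟨fun Y p q => hA.valueOn_eq Y, _, ⟨fun Y p hp => hA.valueOn_eq Y hp _,
    hA.isStratumAssignment⟩, fun B hB => funext fun Y => (hB.1 Y _ _).symm⟩, fun A' hA' => ?_⟩
  refine ⟨_, ⟨fun Y p hp => ?_, hA'.isPointwiseAssignment hX⟩, fun B hB => funext fun p => ?_⟩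
  · obtain rfl := Stratum.eq_of_mem hp
    rfl
  · rw [← hB.1 _ p (Stratum.mem_of p)]
    rfl

end TorusAssignment

namespace TorusAssignment
open Set Filter Topology Pointwise

/-! ### Semicontinuity of the infinitesimal isotropy -/

theorem continuous_smul_torusExp {n : ℕ} : Continuous fun z : ℝ × (Fin n → ℝ) =>
    torusExp (z.1 • z.2) :=
  continuous_torusExp.comp (by fun_prop)

theorem torusExp_zsmul_mem {n : ℕ} {H : Subgroup (Torus n)} {ξ : Fin n → ℝ}
    (h : torusExp ξ ∈ H) (m : ℤ) : torusExp ((m : ℝ) • ξ) ∈ H := by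
  have : torusExp ((m : ℝ) • ξ) = torusExp ξ ^ m := by
    funext i
    simp [torusExp, ← zsmul_eq_mul, Circle.exp_zsmul]
  exact this ▸ H.zpow_mem h m

/-- A closed subgroup of the torus is transverse, near the identity, to every subspace that meets
its Lie algebra trivially. -/
theorem eventually_torusExp_notMem {n : ℕ} {H : Subgroup (Torus n)}
    (hH : IsClosed (H : Set (Torus n))) {W : Submodule ℝ (Fin n → ℝ)}
    (hW : Disjoint W (lieAlg H)) : ∀ᶠ w in 𝓝 (0 : Fin n → ℝ), w ∈ W → w ≠ 0 → torusExp w ∉ H := by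
  by_contra hcon
  rw [not_eventually, frequently_iff_neBot] at hcon
  -- An ultrafilter of counterexamples tending to `0` plays the role of a sequence; compactness of
  -- the sphere makes the directions `w / ‖w‖` converge along it.
  obtain ⟨G, hG'⟩ := Ultrafilter.exists_le
    (𝓝 (0 : Fin n → ℝ) ⊓ 𝓟 {w | ¬(w ∈ W → w ≠ 0 → torusExp w ∉ H)})
  obtain ⟨hG0, hG⟩ := le_inf_iff.1 hG'
  have hG : ∀ᶠ w in (G : Filter (Fin n → ℝ)), ¬(w ∈ W → w ≠ 0 → torusExp w ∉ H) :=
    le_principal_iff.1 hG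
  have hnorm : Tendsto (fun w : Fin n → ℝ => ‖w‖) G (𝓝 0) := by
    simpa using (continuous_norm.tendsto (0 : Fin n → ℝ)).mono_left hG0
  have hdir : (Ultrafilter.map (fun w : Fin n → ℝ => ‖w‖⁻¹ • w) G : Filter (Fin n → ℝ))
      ≤ 𝓟 (Metric.sphere (0 : Fin n → ℝ) 1) := by
    rw [le_principal_iff, Ultrafilter.coe_map, mem_map]
    filter_upwards [hG] with w hw
    push Not at hw
    simp [norm_smul, hw.2.1]
  obtain ⟨u, hu, hGu⟩ := (isCompact_sphere (0 : Fin n → ℝ) 1).ultrafilter_le_nhds _ hdir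
  have hGu : Tendsto (fun w : Fin n → ℝ => ‖w‖⁻¹ • w) G (𝓝 u) := hGu
  have huW : u ∈ W := by
    refine W.closed_of_finiteDimensional.mem_of_tendsto hGu ?_
    filter_upwards [hG] with w hw
    push Not at hw
    exact W.smul_mem _ hw.1
  have huH : u ∈ lieAlg H := by
    intro s
    -- The integer multiples `⌊s / ‖w‖⌋ • w` have exponentials in `H` and converge to `s • u`,
    -- because rounding costs at most `‖w‖ → 0`. Closedness of `H` then puts the limit direction `u`
    -- in its Lie algebra.
    have hfl : Tendsto (fun w : Fin n → ℝ => (⌊s / ‖w‖⌋ : ℝ) * ‖w‖) G (𝓝 s) := by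
      rw [tendsto_iff_norm_sub_tendsto_zero]
      refine squeeze_zero' (.of_forall fun _ => norm_nonneg _) ?_ hnorm
      filter_upwards [hG] with w hw
      push Not at hw
      have hpos : 0 < ‖w‖ := norm_pos_iff.2 hw.2.1
      have h1 := Int.floor_le (s / ‖w‖)
      have h2 := Int.lt_floor_add_one (s / ‖w‖)
      rw [le_div_iff₀ hpos] at h1
      rw [div_lt_iff₀ hpos] at h2
      rw [Real.norm_eq_abs, abs_le]
      constructor <;> nlinarith
    refine hH.mem_of_tendsto ((continuous_smul_torusExp.tendsto (s, u)).comp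
      (hfl.prodMk_nhds hGu)) ?_
    filter_upwards [hG] with w hw
    push Not at hw
    have hpos : ‖w‖ ≠ 0 := norm_ne_zero_iff.2 hw.2.1
    simpa [smul_smul, mul_assoc, hpos] using torusExp_zsmul_mem hw.2.2 ⌊s / ‖w‖⌋
  have := Submodule.disjoint_def.1 hW u huW huH
  simp [this] at hu

/-- Choose a complement `W` of `𝔱_p`. The compact set `exp(S) · T_p`, with `S` a small sphere in
`W`, contains no element fixing `p`, hence none fixing a nearby `q`. A vector of `𝔱_q` with nonzero
`W`-component could be rescaled to exponentiate into this set. -/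
theorem eventually_isotropy_le {n : ℕ} {X : Type*} [TopologicalSpace X] [T2Space X]
    [MulAction (Torus n) X] [ContinuousSMul (Torus n) X] (p : X) :
    ∀ᶠ q in 𝓝 p, isotropy n q ≤ isotropy n p := by
  obtain ⟨W, hW⟩ := (isotropy n p).exists_isCompl
  obtain ⟨r, hr, hball⟩ := Metric.eventually_nhds_iff.1
    (eventually_torusExp_notMem (isClosed_stabilizer p) hW.symm.disjoint)
  have hr2 : 0 < r / 2 := by positivity
  let S : Set (Fin n → ℝ) := W ∩ Metric.sphere 0 (r / 2)
  have hS : IsCompact S :=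
    (isCompact_sphere _ _).inter_left W.closed_of_finiteDimensional
  have hC : IsCompact (torusExp '' S * (MulAction.stabilizer (Torus n) p : Set (Torus n))) :=
    (hS.image continuous_torusExp).mul (isClosed_stabilizer p).isCompact
  have hev : ∀ᶠ q in 𝓝 p, ∀ g ∈ torusExp '' S * (MulAction.stabilizer (Torus n) p : Set (Torus n)),
      g • q ≠ q := by
    refine hC.eventually_forall_of_forall_eventually fun g hg => ?_
    obtain ⟨_, ⟨w, hw, rfl⟩, k, hk, rfl⟩ := hg
    refine (isOpen_ne_fun (f := fun z : X × Torus n => z.2 • z.1) (g := fun z => z.1)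
      (by fun_prop) (by fun_prop)).mem_nhds ?_
    have hwr : ‖w‖ = r / 2 := by simpa using hw.2
    have h1 := hball (by rw [dist_zero_right, hwr]; linarith) hw.1
      (by rintro rfl; simp at hwr; linarith)
    rw [SetLike.mem_coe, MulAction.mem_stabilizer_iff] at hk
    change (torusExp w * k) • p ≠ p
    rwa [mul_smul, hk]
  filter_upwards [hev] with q hq ξ hξ
  obtain ⟨ζ, hζ, η, hη, rfl⟩ := Submodule.mem_sup.1 (hW.sup_eq_top ▸ Submodule.mem_top : ξ ∈ _)
  by_cases h0 : η = 0
  · simpa [h0] using hζ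
  have hpos : ‖η‖ ≠ 0 := norm_ne_zero_iff.2 h0
  -- This factor brings the `W`-component of `ξ` to norm `r / 2`; the `𝔱_p`-component exponentiates
  -- into `T_p` at any scale.
  refine absurd (hξ (r / 2 / ‖η‖)) (hq _ ⟨torusExp ((r / 2 / ‖η‖) • η), ⟨_, ⟨W.smul_mem _ hη, ?_⟩,
    rfl⟩, torusExp ((r / 2 / ‖η‖) • ζ), hζ _, ?_⟩)
  · simp [norm_smul, hpos, abs_of_pos hr]
  · simp only [smul_add, torusExp_add, mul_comm]

end TorusAssignment

namespace TorusAssignment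
open Set Filter Topology MeasureTheory

/-! ### Linearisation of a compact group action at a fixed point -/

section Linearization

variable {G : Type*} [Group G] [TopologicalSpace G] {X : Type*} [TopologicalSpace X]
  [MulAction G X] {E : Type*} [NormedAddCommGroup E] [NormedSpace ℝ E]

/-- `ρ k` is the derivative at `p` of the action of `k` in the chart `φ`, locally uniformly
in `k` in the sense of strict differentiability. -/
def IsIsotropyRep (φ : OpenPartialHomeomorph X E) (p : X) (ρ : G → E →L[ℝ] E) : Prop :=
  ∀ k : G, ∀ ε > 0, ∀ᶠ z : G × E × E in 𝓝 (k, φ p, φ p),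
    ‖φ (z.1 • φ.symm z.2.1) - φ (z.1 • φ.symm z.2.2) - ρ k (z.2.1 - z.2.2)‖
      ≤ ε * ‖z.2.1 - z.2.2‖

namespace IsIsotropyRep

variable {φ : OpenPartialHomeomorph X E} {p : X} {ρ : G → E →L[ℝ] E}

theorem hasStrictFDerivAt (h : IsIsotropyRep φ p ρ) (k : G) :
    HasStrictFDerivAt (fun x => φ (k • φ.symm x)) (ρ k) (φ p) := by
  refine .of_isLittleO (Asymptotics.isLittleO_iff.2 fun ε hε => ?_)
  have hc : Tendsto (fun z : E × E => (k, z)) (𝓝 (φ p, φ p)) (𝓝 (k, φ p, φ p)) :=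
    (by fun_prop : Continuous fun z : E × E => (k, z)).tendsto _
  exact hc.eventually (h k ε hε)

theorem map_one (h : IsIsotropyRep φ p ρ) (hp : p ∈ φ.source) :
    ρ 1 = ContinuousLinearMap.id ℝ E := by
  refine (h.hasStrictFDerivAt 1).hasFDerivAt.unique
    ((hasFDerivAt_id (φ p)).congr_of_eventuallyEq ?_)
  filter_upwards [φ.eventually_right_inverse (φ.map_source hp)] with x hx
  simpa using hx

theorem map_mul [ContinuousConstSMul G X] (h : IsIsotropyRep φ p ρ) (hp : p ∈ φ.source)
    (hfix : ∀ k : G, k • p = p) (k l : G) : ρ (k * l) = (ρ k).comp (ρ l) := by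
  have hl : φ (l • φ.symm (φ p)) = φ p := by rw [φ.left_inv hp, hfix]
  have hk := h.hasStrictFDerivAt k
  rw [← hl] at hk
  refine (h.hasStrictFDerivAt (k * l)).hasFDerivAt.unique
    ((hk.comp (φ p) (h.hasStrictFDerivAt l)).hasFDerivAt.congr_of_eventuallyEq ?_)
  have hcont : Tendsto (fun x => l • φ.symm x) (𝓝 (φ p)) (𝓝 p) := by
    have := φ.continuousAt_symm (φ.map_source hp)
    rw [ContinuousAt, φ.left_inv hp] at this
    simpa only [hfix] using this.const_smul l
  filter_upwards [hcont.eventually (φ.open_source.mem_nhds hp)] with x hx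
  simp only [φ.left_inv hx, mul_smul]

/-- The estimate at `k` also holds for group elements `l` near `k`, still with `ρ k`. So the map of
`l` minus `ρ k` is Lipschitz at `φ p` with a small constant, which bounds its derivative `ρ l - ρ
k`. -/
theorem continuous (h : IsIsotropyRep φ p ρ) : Continuous ρ := by
  refine continuous_iff_continuousAt.2 fun k => Metric.tendsto_nhds.2 fun ε hε => ?_
  have h1 := h k (ε / 2) (half_pos hε)
  rw [nhds_prod_eq] at h1
  filter_upwards [h1.curry] with l hl
  rw [dist_eq_norm]
  refine lt_of_le_of_lt ?_ (half_lt_self hε)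
  refine ((h.hasStrictFDerivAt l).hasFDerivAt.sub (ρ k).hasFDerivAt).le_of_lip' (half_pos hε).le ?_
  have hc : Tendsto (fun x : E => (x, φ p)) (𝓝 (φ p)) (𝓝 (φ p, φ p)) :=
    (by fun_prop : Continuous fun x : E => (x, φ p)).tendsto _
  filter_upwards [hc.eventually hl] with x hx
  convert hx using 2
  simp only [Pi.sub_apply, map_sub]
  abel

theorem eventually_forall [CompactSpace G] (h : IsIsotropyRep φ p ρ) {ε : ℝ} (hε : 0 < ε) :
    ∀ᶠ z : E × E in 𝓝 (φ p, φ p), ∀ k : G,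
      ‖φ (k • φ.symm z.1) - φ (k • φ.symm z.2) - ρ k (z.1 - z.2)‖ ≤ ε * ‖z.1 - z.2‖ := by
  have := (isCompact_univ (X := G)).eventually_forall_of_forall_eventually (x₀ := (φ p, φ p))
    (P := fun (z : E × E) (k : G) =>
      ‖φ (k • φ.symm z.1) - φ (k • φ.symm z.2) - ρ k (z.1 - z.2)‖ ≤ ε * ‖z.1 - z.2‖) ?_
  · simpa using this
  intro k _
  have hρ : ∀ᶠ l in 𝓝 k, ‖ρ l - ρ k‖ < ε / 2 := by
    simpa [dist_eq_norm] using
      Metric.tendsto_nhds.1 (h.continuous.tendsto k) (ε / 2) (half_pos hε)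
  have hsw : Tendsto (Prod.swap : (E × E) × G → G × E × E) (𝓝 ((φ p, φ p), k))
    (𝓝 (k, φ p, φ p)) := continuous_swap.tendsto _
  filter_upwards [hsw.eventually (h k (ε / 2) (half_pos hε)),
    (continuous_snd.tendsto ((φ p, φ p), k)).eventually hρ] with z h1 h2
  simp only [Prod.fst_swap, Prod.snd_swap] at h1
  have h3 : ‖(ρ z.2 - ρ k) (z.1.1 - z.1.2)‖ ≤ ε / 2 * ‖z.1.1 - z.1.2‖ :=
    (ContinuousLinearMap.le_opNorm _ _).trans (by gcongr)
  calc _ = ‖(φ (z.2 • φ.symm z.1.1) - φ (z.2 • φ.symm z.1.2) - ρ k (z.1.1 - z.1.2))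
        - (ρ z.2 - ρ k) (z.1.1 - z.1.2)‖ := by
          congr 1; simp only [_root_.sub_apply]; abel
    _ ≤ _ := norm_sub_le _ _
    _ ≤ _ := by linarith

/-- Bochner linearisation: near a fixed point of a compact group there is a chart in which the
group acts linearly. -/
theorem exists_equivariant_chart [IsTopologicalGroup G] [CompactSpace G]
    [ContinuousSMul G X] [CompleteSpace E] (h : IsIsotropyRep φ p ρ) (hp : p ∈ φ.source)
    (hfix : ∀ k : G, k • p = p) :
    ∃ e : OpenPartialHomeomorph X E, p ∈ e.source ∧ e p = 0 ∧
      ∀ (k : G), ∀ x ∈ e.source, k • x ∈ e.source → e (k • x) = ρ k (e x) := by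
  borelize G
  let μ : Measure G := Measure.haarMeasure ⊤
  have : IsProbabilityMeasure μ :=
    ⟨by simpa using Measure.haarMeasure_self (K₀ := (⊤ : TopologicalSpace.PositiveCompacts G))⟩
  -- Averaging the chart over Haar measure makes it equivariant; each integrand has derivative `ρ k
  -- ∘ ρ k⁻¹ = id` at `p`, so the average is still a local chart by the inverse function theorem.
  let Φ : X → E := fun x => ∫ k, ρ k (φ (k⁻¹ • x) - φ p) ∂μ
  have hinv (k : G) : (ρ k).comp (ρ k⁻¹) = .id ℝ E := by
    rw [← h.map_mul hp hfix, mul_inv_cancel, h.map_one hp]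
  have hsource : ∀ᶠ x in 𝓝 p, ∀ k : G, k • x ∈ φ.source := by
    have := (isCompact_univ (X := G)).eventually_forall_of_forall_eventually (x₀ := p)
      (P := fun (x : X) (k : G) => k • x ∈ φ.source) fun k _ =>
      (φ.open_source.preimage (by fun_prop : Continuous fun z : X × G => z.2 • z.1)).mem_nhds
        (by simpa [hfix] using hp)
    simpa using this
  have hcts (x : X) (hx : ∀ k : G, k • x ∈ φ.source) :
      Continuous fun k : G => ρ k (φ (k⁻¹ • x) - φ p) := by
    have h1 : Continuous fun k : G => φ (k⁻¹ • x) :=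
      φ.continuousOn.comp_continuous (by fun_prop) fun k => hx _
    exact h.continuous.clm_apply (h1.sub continuous_const)
  have hint (x : X) (hx : ∀ k : G, k • x ∈ φ.source) :
      Integrable (fun k : G => ρ k (φ (k⁻¹ • x) - φ p)) μ :=
    (hcts x hx).integrable_of_hasCompactSupport (HasCompactSupport.of_compactSpace _)
  have hequiv (l : G) (x : X) (hx : ∀ k : G, k • x ∈ φ.source) : Φ (l • x) = ρ l (Φ x) := by
    change ∫ k, ρ k (φ (k⁻¹ • l • x) - φ p) ∂μ = _
    rw [← (ρ l).integral_comp_comm (hint x hx),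
      ← integral_mul_left_eq_self (fun k => ρ k (φ (k⁻¹ • l • x) - φ p)) l]
    refine integral_congr_ae (.of_forall fun k => ?_)
    simp only [h.map_mul hp hfix, smul_smul, mul_inv_rev, inv_mul_cancel_right,
      ContinuousLinearMap.comp_apply]
  obtain ⟨M, hM⟩ := (isCompact_range h.continuous).isBounded.exists_norm_le
  have hM0 : 0 ≤ M := (norm_nonneg _).trans (hM (ρ 1) ⟨1, rfl⟩)
  have hsymm : Tendsto φ.symm (𝓝 (φ p)) (𝓝 p) := by
    have := φ.continuousAt_symm (φ.map_source hp)
    rwa [ContinuousAt, φ.left_inv hp] at this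
  have hstrict : HasStrictFDerivAt (fun x => Φ (φ.symm x))
      (ContinuousLinearEquiv.refl ℝ E : E →L[ℝ] E) (φ p) := by
    refine .of_isLittleO (Asymptotics.isLittleO_iff.2 fun ε hε => ?_)
    have hpos : 0 < ε / (M + 1) := by positivity
    have hs := hsymm.eventually hsource
    filter_upwards [h.eventually_forall hpos,
      (continuous_fst.tendsto (φ p, φ p)).eventually hs,
      (continuous_snd.tendsto (φ p, φ p)).eventually hs] with z hz h1 h2
    -- As `μ` has total mass one, the increment is its own average, and the error can be estimated
    -- integrand by integrand.
    have hconst : z.1 - z.2 = ∫ _ : G, (z.1 - z.2) ∂μ := by simp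
    have hrefl : (ContinuousLinearEquiv.refl ℝ E : E →L[ℝ] E) (z.1 - z.2) = z.1 - z.2 := rfl
    rw [hrefl]
    nth_rw 1 [hconst]
    rw [← integral_sub (hint _ h1) (hint _ h2)]
    have hsub := integral_sub ((hint _ h1).sub (hint _ h2)) (integrable_const (z.1 - z.2))
    simp only [Pi.sub_apply] at hsub
    rw [← hsub]
    refine (norm_integral_le_of_norm_le_const (C := ε * ‖z.1 - z.2‖)
      (.of_forall fun k => ?_)).trans (by simp)
    have hk : ρ k (φ (k⁻¹ • φ.symm z.1) - φ p) - ρ k (φ (k⁻¹ • φ.symm z.2) - φ p) - (z.1 - z.2)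
        = ρ k (φ (k⁻¹ • φ.symm z.1) - φ (k⁻¹ • φ.symm z.2) - ρ k⁻¹ (z.1 - z.2)) := by
      have := congrArg (fun f : E →L[ℝ] E => f (z.1 - z.2)) (hinv k)
      simp only [ContinuousLinearMap.comp_apply, ContinuousLinearMap.id_apply] at this
      rw [map_sub (ρ k) _ (ρ k⁻¹ _), this, ← map_sub, sub_sub_sub_cancel_right]
    rw [hk]
    calc _ ≤ ‖ρ k‖ * _ := ContinuousLinearMap.le_opNorm _ _
      _ ≤ (M + 1) * (ε / (M + 1) * ‖z.1 - z.2‖) := by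
        gcongr
        · exact (hM _ ⟨k, rfl⟩).trans (by linarith)
        · exact hz k⁻¹
      _ = _ := by field_simp
  let e' := hstrict.toOpenPartialHomeomorph (fun x => Φ (φ.symm x))
  obtain ⟨V, hV, hVo, hpV⟩ := eventually_nhds_iff.1 hsource
  have heq (x : X) (hx : x ∈ φ.source) : e' (φ x) = Φ x := by
    simp only [e', HasStrictFDerivAt.toOpenPartialHomeomorph_coe, φ.left_inv hx]
  have hmem : p ∈ (φ.trans e').source :=
    ⟨hp, hstrict.mem_toOpenPartialHomeomorph_source⟩
  refine ⟨(φ.trans e').restrOpen V hVo, ⟨hmem, hpV⟩, ?_, fun k x hx hkx => ?_⟩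
  · change e' (φ p) = 0
    rw [heq p hp]
    simp [Φ, hfix]
  · change e' (φ (k • x)) = ρ k (e' (φ x))
    rw [heq _ hx.1.1, heq _ hkx.1.1, hequiv k x (hV x hx.2)]

end IsIsotropyRep

end Linearization

end TorusAssignment

namespace TorusAssignment
open Set Filter Topology

/-! ### Smooth torus actions are locally conical -/

theorem range_torusModel (n : ℕ) : range (torusModel n) = univ := by
  have h : range (torusModel n) = range (Pi.map fun _ : Fin n => ((𝓡 1 : _) : _ → _)) := rfl
  rw [h, range_piMap]
  simp

instance (n : ℕ) : (torusModel n).Boundaryless := ⟨range_torusModel n⟩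

section Smooth

variable {n : ℕ} {E : Type*} [NormedAddCommGroup E] [NormedSpace ℝ E]
  {X : Type*} [TopologicalSpace X] [ChartedSpace E X] [MulAction (Torus n) X]
  [ContMDiffSMul (torusModel n) 𝓘(ℝ, E) ∞ (Torus n) X]

variable (E) in
-- Joint smoothness gives a strict derivative in the group and space variables together. Comparing
-- two points with the same group coordinate leaves only its partial derivative along `E`, with a
-- bound uniform in nearby group elements.
theorem exists_strict_bound {p : X} {k : Torus n} (hk : k • p = p) :
    ∃ L : E →L[ℝ] E, ∀ ε > 0, ∀ᶠ z : Torus n × E × E in 𝓝 (k, chartAt E p p, chartAt E p p),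
      ‖chartAt E p (z.1 • (chartAt E p).symm z.2.1) - chartAt E p (z.1 • (chartAt E p).symm z.2.2)
        - L (z.2.1 - z.2.2)‖ ≤ ε * ‖z.2.1 - z.2.2‖ := by
  have hsm : ContMDiffAt ((torusModel n).prod 𝓘(ℝ, E)) 𝓘(ℝ, E) ∞
      (fun z : Torus n × X => z.1 • z.2) (k, p) := ContMDiffSMul.contMDiff_smul (k, p)
  have h := (contMDiffAt_iff.1 hsm).2
  rw [ModelWithCorners.range_eq_univ, contDiffWithinAt_univ] at h
  obtain ⟨D, hd⟩ : ∃ D, HasStrictFDerivAt _ D _ := ⟨_, h.hasStrictFDerivAt (by simp)⟩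
  have hD : HasStrictFDerivAt (fun z : (Fin n → EuclideanSpace ℝ (Fin 1)) × E =>
      chartAt E p ((extChartAt (torusModel n) k).symm z.1 • (chartAt E p).symm z.2)) D
      (extChartAt (torusModel n) k k, chartAt E p p) := by
    simp only [extChartAt_prod, hk] at hd
    exact hd
  refine ⟨D.comp (.inr ℝ _ E), fun ε hε => ?_⟩
  have h2 := Asymptotics.isLittleO_iff.1 hD.isLittleO hε
  have hu : ContinuousAt (extChartAt (torusModel n) k) k := continuousAt_extChartAt k
  have hc : ContinuousAt (fun z : Torus n × E × E =>
      ((extChartAt (torusModel n) k z.1, z.2.1), (extChartAt (torusModel n) k z.1, z.2.2)))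
      (k, chartAt E p p, chartAt E p p) := by
    have h1 : ContinuousAt (fun z : Torus n × E × E => extChartAt (torusModel n) k z.1)
      (k, chartAt E p p, chartAt E p p) :=
      ContinuousAt.comp (g := extChartAt (torusModel n) k) hu continuousAt_fst
    fun_prop
  filter_upwards [hc.eventually h2,
    continuousAt_fst.preimage_mem_nhds (extChartAt_source_mem_nhds (I := torusModel n) k)]
    with z hz1 hz2
  simp only [(extChartAt (torusModel n) k).left_inv hz2, Prod.mk_sub_mk, sub_self] at hz1
  simpa using hz1

variable (E) in
theorem exists_isIsotropyRep {p : X} {K : Subgroup (Torus n)} (hK : ∀ k : K, k • p = p) :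
    ∃ ρ : K → E →L[ℝ] E, IsIsotropyRep (chartAt E p) p ρ := by
  choose ρ hρ using fun k : K => exists_strict_bound E (hK k : (k : Torus n) • p = p)
  refine ⟨ρ, fun k ε hε => ?_⟩
  have hc : Tendsto (fun z : K × E × E => ((z.1 : Torus n), z.2))
      (𝓝 (k, chartAt E p p, chartAt E p p)) (𝓝 ((k : Torus n), chartAt E p p, chartAt E p p)) :=
    (by fun_prop : Continuous fun z : K × E × E => ((z.1 : Torus n), z.2)).tendsto _
  exact hc.eventually (hρ k ε hε)

variable (E) in
theorem isLocallyConical [T2Space X] [ContinuousSMul (Torus n) X] [CompleteSpace E] (p : X) :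
    IsLocallyConical n p := by
  -- This compact group fixes `p` and contains every one-parameter group with direction in `𝔱_p`, so
  -- it detects the infinitesimal isotropy of every nearby point.
  let K := expClosure (isotropy n p)
  have hK : ∀ k : K, k • p = p := mem_fixedPoints_expClosure le_rfl
  have : CompactSpace K := isCompact_iff_compactSpace.1 (isClosed_expClosure _).isCompact
  obtain ⟨ρ, hρ⟩ := exists_isIsotropyRep E hK
  obtain ⟨e, hpe, hep, he⟩ := hρ.exists_equivariant_chart (mem_chart_source E p) hK
  have hN : ∀ᶠ x in 𝓝 p, x ∈ e.source ∧ (∀ k : K, k • x ∈ e.source) ∧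
      isotropy n x ≤ isotropy n p := by
    refine (e.open_source.eventually_mem hpe).and (.and ?_ (eventually_isotropy_le p))
    have := (isCompact_univ (X := K)).eventually_forall_of_forall_eventually (x₀ := p)
      (P := fun (x : X) (k : K) => k • x ∈ e.source) fun k _ =>
      (e.open_source.preimage (by fun_prop : Continuous fun z : X × K => z.2 • z.1)).mem_nhds
        (by simpa [hK] using hpe)
    simpa using this
  have hiff (x : X) (hx : x ∈ e.source) (hKx : ∀ k : K, k • x ∈ e.source) (k : K) :
      k • x = x ↔ ρ k (e x) = e x := by
    rw [← he k x hx (hKx k)]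
    exact ⟨congrArg e, fun h => e.injOn (hKx k) hx h⟩
  have hsymm : Tendsto e.symm (𝓝 (e p)) (𝓝 p) := by
    have := e.continuousAt_symm (e.map_source hpe)
    rwa [ContinuousAt, e.left_inv hpe] at this
  obtain ⟨r, hr, hball⟩ := Metric.eventually_nhds_iff_ball.1
    ((hsymm.eventually hN).and (e.open_target.eventually_mem (e.map_source hpe)))
  refine ⟨_, hN.and ((e.continuousAt hpe).eventually (Metric.ball_mem_nhds _ hr)), ?_⟩
  rintro q ⟨⟨hq, hKq, hqp⟩, hqr⟩ y ⟨⟨hy, hKy, -⟩, hyr⟩ hyp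
  have hfix (k : K) : ρ k (e y) = e y :=
    (hiff y hy hKy k).1 (mem_fixedPoints_expClosure hyp.ge k)
  let γ : ℝ → X := fun s => e.symm (AffineMap.lineMap (e y) (e q) s)
  have hmem (s : ℝ) (hs : s ∈ Icc (0 : ℝ) 1) :
      AffineMap.lineMap (e y) (e q) s ∈ Metric.ball (e p) r :=
    (convex_ball _ _).lineMap_mem hyr hqr hs
  have hγ : ContinuousOn γ (Icc 0 1) :=
    e.continuousOn_symm.comp (by fun_prop) fun s hs => (hball _ (hmem s hs)).2
  have hγ0 : γ 0 = y := by simp [γ, e.left_inv hy]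
  have hγ1 : γ 1 = q := by simp [γ, e.left_inv hq]
  have hiso : γ '' Ioc 0 1 ⊆ {x | isotropy n x = isotropy n q} := by
    rintro _ ⟨s, hs, rfl⟩
    obtain ⟨⟨hs1, hs2, hs3⟩, hs4⟩ := hball _ (hmem s (Ioc_subset_Icc_self hs))
    -- In the linear chart the point is `e y + s (e q - e y)` with `e y` fixed by `ρ k`; since `s ≠
    -- 0`, it is fixed exactly when `e q` is. At `s = 0` the isotropy may jump, hence the half-open
    -- interval.
    have hstab (k : K) : k • γ s = γ s ↔ k • q = q := by
      rw [hiff _ hs1 hs2, hiff q hq hKq, e.right_inv hs4, AffineMap.lineMap_apply_module',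
        map_add, map_smul, map_sub, hfix, add_left_inj, smul_right_inj hs.1.ne', sub_left_inj]
    ext ξ
    constructor
    · intro hξ t
      exact (hstab ⟨_, torusExp_mem_expClosure ((isotropy n p).smul_mem t (hs3 hξ))⟩).1 (hξ t)
    · intro hξ t
      exact (hstab ⟨_, torusExp_mem_expClosure ((isotropy n p).smul_mem t (hqp hξ))⟩).2 (hξ t)
  have hsub : γ '' Ioc 0 1 ⊆ (Stratum.of n q).carrier :=
    (isPreconnected_Ioc.image γ (hγ.mono Ioc_subset_Icc_self)).subset_connectedComponentIn
      ⟨1, by simp, hγ1⟩ hiso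
  refine closure_mono hsub (hγ0 ▸ ?_)
  exact ((hγ 0 (by simp)).mono Ioc_subset_Icc_self).mem_closure_image (by simp [closure_Ioc])

end Smooth

end TorusAssignment

open TorusAssignment
theorem proposition3p2
    (n : ℕ) {E : Type*} [NormedAddCommGroup E] [NormedSpace ℝ E] [FiniteDimensional ℝ E]
    {X : Type*} [TopologicalSpace X] [T2Space X] [ChartedSpace E X] [IsManifold 𝓘(ℝ, E) ∞ X]
    [MulAction (Torus n) X] [ContinuousSMul (Torus n) X]
    [ContMDiffSMul (torusModel n) 𝓘(ℝ, E) ∞ (Torus n) X] :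
    -- part (a)
    (∀ A : ∀ p : X, polyFun (isotropy n p), IsPointwiseAssignment A →
      (∀ (Y : Stratum n X) (p q : X) (hp : p ∈ Y.carrier) (hq : q ∈ Y.carrier),
        valueOn A Y hp = valueOn A Y hq) ∧
      ∃! A' : ∀ Y : Stratum n X, polyFun Y.lie,
        (∀ (Y : Stratum n X) (p : X) (hp : p ∈ Y.carrier), valueOn A Y hp = A' Y) ∧
        IsStratumAssignment A') ∧
    -- part (b)
    (∀ A' : ∀ Y : Stratum n X, polyFun Y.lie, IsStratumAssignment A' →
      ∃! A : ∀ p : X, polyFun (isotropy n p),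
        (∀ (Y : Stratum n X) (p : X) (hp : p ∈ Y.carrier), valueOn A Y hp = A' Y) ∧
        IsPointwiseAssignment A) := by
  have : CompleteSpace E := FiniteDimensional.complete ℝ E
  exact assignments_equivalent fun p => isLocallyConical E p
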